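/- Let $\mathbb{T}=\mathbb{R}/2\pi\mathbb{Z}$, let $\mathcal{M}(\mathbb{T})$ be the space of real (finite, signed) Radon measures on $\mathbb{T}$ with the total-variation norm $\|w\|_{\mathcal M}=|w|(\mathbb{T})$, and let $\mathcal{M}_+(\mathbb{T})$ be the subset of nonnegative measures. For $w\in\mathcal{M}(\mathbb{T})$ and $k\in\mathbb{Z}$ put $\widehat{w}[k]=\int_{\mathbb{T}}e^{-ikt}\,\mathrm{d}w(t)$. Let $K_c\in\mathbb{N}$ and $\boldsymbol{y}=(y_0,y_1,\dots,y_{K_c})\in\mathbb{R}\times\mathbb{C}^{K_c}$, write $\boldsymbol{\nu}(w)=(\widehat{w}[0],\dots,\widehat{w}[K_c])\in\mathbb{R}\times\mathbb{C}^{K_c}$, and consider the problem $$\text{(BPC)}\qquad \min_{w\in\mathcal{M}(\mathbb{T}),\ \boldsymbol{\nu}(w)=\boldsymbol{y}}\ \|w\|_{\mathcal{M}}.$$ **Theorem.** The following conditions are equivalent: 1. there exists $w_0\in\mathcal{M}_+(\mathbb{T})$ such that $\boldsymbol{\nu}(w_0)=\boldsymbol{y}$; 2. the solution set of (BPC) is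 $\{w\in\mathcal{M}_+(\mathbb{T}) : \boldsymbol{\nu}(w)=\boldsymbol{y}\}$; 3. $y_0=\min_{w\in\mathcal{M}(\mathbb{T}),\ \boldsymbol{\nu}(w)=\boldsymbol{y}}\|w\|_{\mathcal{M}}$ (the minimum being attained). Moreover, if $y_0\ge 0$ and these equivalent conditions fail, then (BPC) has a unique solution, and this solution is of the form $\sum_{i=1}^{n}a_i\,\delta_{x_i}$ with $n\le 2K_c$, pairwise distinct $x_i\in\mathbb{T}$, nonzero real weights $a_i$, at least one $a_i>0$ and at least one $a_i<0$. -/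

import Mathlib

open MeasureTheory

namespace FourierTV

/-- The torus `ℝ / 2πℤ`, with its Borel `σ`-algebra. -/
abbrev Torus : Type := AddCircle (2 * Real.pi)

/-- The real (finite, signed) Radon measures on the torus. As the torus is a compact metric space,
every finite signed Borel measure on it is Radon. -/
abbrev RadonMeasure : Type := SignedMeasure Torus

/-- The total-variation norm `‖w‖ = |w|(𝕋)`. -/
noncomputable def tvNorm (w : RadonMeasure) : ℝ :=
  w.totalVariation.real Set.univ

/-- The Fourier coefficient `ŵ[k] = ∫ e^{-ikt} dw(t)`. -/
noncomputable def fourierCoeff (w : RadonMeasure) (k : ℤ) : ℂ :=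
  ∫ᵛ t, fourier (-k) t ∂<•w

/-- The character being integrated is `t ↦ e^{-ikt}`. -/
theorem fourier_neg_apply (k : ℤ) (t : ℝ) :
    fourier (-k) (t : Torus) = Complex.exp (-(Complex.I * k * t)) := by
  rw [fourier_coe_apply]
  congr 1
  have h : (Real.pi : ℂ) ≠ 0 := by exact_mod_cast Real.pi_ne_zero
  push_cast
  field_simp

/-- The zeroth Fourier coefficient is the (real) total mass. -/
theorem fourierCoeff_zero (w : RadonMeasure) : fourierCoeff w 0 = (w Set.univ : ℂ) := by
  have : IsFiniteMeasure w.variation := by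
    rw [← SignedMeasure.totalVariation_eq_variation]; infer_instance
  simp [fourierCoeff, VectorMeasure.integral_const]

/-- The low-pass Fourier coefficients `(ŵ[0], ŵ[1], …, ŵ[K])`, an element of `ℝ × ℂ^K`. -/
noncomputable def lowPass (K : ℕ) (w : RadonMeasure) : ℝ × (Fin K → ℂ) :=
  ((fourierCoeff w 0).re, fun k => fourierCoeff w ((k : ℤ) + 1))

/-- The solution set of the problem of minimizing `‖w‖` among the Radon measures `w` whose low-pass
Fourier coefficients are `y`. -/
def solutionSet (K : ℕ) (y : ℝ × (Fin K → ℂ)) : Set RadonMeasure :=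
  {w | lowPass K w = y ∧ ∀ v : RadonMeasure, lowPass K v = y → tvNorm w ≤ tvNorm v}

/-- The set of nonnegative Radon measures whose low-pass Fourier coefficients are `y`. -/
def nonnegRepresenting (K : ℕ) (y : ℝ × (Fin K → ℂ)) : Set RadonMeasure :=
  {w | 0 ≤ w ∧ lowPass K w = y}

end FourierTV

namespace FourierTV

/-! Every feasible `w` has the same total mass `w(𝕋) = y₀`, and `w(𝕋) ≤ ‖w‖` with equality exactly
when `w ≥ 0` (`tvNorm_eq_apply_univ_iff`). So as soon as one nonnegative feasible measure exists,
the minimum is `y₀` and the minimizers are the nonnegative feasible measures. The converse from the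
solution set also needs a minimizer to exist (`solutionSet_nonempty`); this reduces to compactness
in finite dimension, because the unit ball has as image the convex hull of the moment curve and its
opposite.

If no nonnegative feasible measure exists and `y₀ ≥ 0`, the minimum exceeds `y₀`. Hahn–Banach gives
a trigonometric polynomial `p` of degree at most `K` with `|p| ≤ 1` whose pairing with `y` is the
minimum; `p` is not constant, since a constant pairs to at most `y₀`. Every minimizer lives on `{|p|
= 1}`, which lies among the at most `2K` zeros of `p'`. Moments at that many points are linearly
independent (Vandermonde), so the weights are determined. Weights of a single sign would make the
norm at most `|y₀| = y₀`. -/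

instance (w : RadonMeasure) : IsFiniteMeasure w.variation := by
  rw [← SignedMeasure.totalVariation_eq_variation]; infer_instance

theorem tvNorm_eq_variation (w : RadonMeasure) : tvNorm w = w.variation.real Set.univ := by
  rw [tvNorm, SignedMeasure.totalVariation_eq_variation]

theorem tvNorm_nonneg (w : RadonMeasure) : 0 ≤ tvNorm w := measureReal_nonneg

theorem tvNorm_add_le (v w : RadonMeasure) : tvNorm (v + w) ≤ tvNorm v + tvNorm w := by
  simp only [tvNorm_eq_variation]
  rw [← measureReal_add_apply]
  exact ENNReal.toReal_mono (measure_ne_top _ _) (VectorMeasure.variation_add_le _)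

theorem tvNorm_smul (c : ℝ) (w : RadonMeasure) : tvNorm (c • w) = |c| * tvNorm w := by
  simp only [tvNorm_eq_variation, VectorMeasure.variation_smul, measureReal_nnreal_smul_apply,
    coe_nnnorm, Real.norm_eq_abs]

theorem tvNorm_dirac (x : Torus) (a : ℝ) : tvNorm (VectorMeasure.dirac x a) = |a| := by
  simp [tvNorm_eq_variation, Measure.real]

theorem tvNorm_eq_posPart_add_negPart (w : RadonMeasure) :
    tvNorm w = w.toJordanDecomposition.posPart.real Set.univ +
      w.toJordanDecomposition.negPart.real Set.univ := by
  rw [tvNorm, SignedMeasure.totalVariation, measureReal_add_apply]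

theorem nonneg_iff_negPart_univ_eq_zero (w : RadonMeasure) :
    0 ≤ w ↔ w.toJordanDecomposition.negPart.real Set.univ = 0 := by
  refine ⟨fun h => ?_, fun h => VectorMeasure.le_iff.2 fun i hi => ?_⟩
  · obtain ⟨i, hi₁, hi₂, hi₃, -, hneg⟩ := w.toJordanDecomposition_spec
    refine le_antisymm ?_ measureReal_nonneg
    rw [hneg, SignedMeasure.toMeasureOfLEZero_real_apply _ hi₃ hi₁.compl MeasurableSet.univ]
    simpa using h (iᶜ ∩ Set.univ) (hi₁.compl.inter .univ)
  · rw [w.apply_eq_posPart_real_sub_negPart_real hi]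
    have h' : w.toJordanDecomposition.negPart.real i = 0 :=
      le_antisymm (h ▸ measureReal_mono (Set.subset_univ i)) measureReal_nonneg
    rw [h']
    simp

theorem apply_univ_le_tvNorm (w : RadonMeasure) : w Set.univ ≤ tvNorm w :=
  (le_abs_self _).trans (w.norm_le_totalVariation Set.univ)

/-- The norm is the sum of the masses of the Jordan parts and the total mass is their difference, so
equality kills the negative part. -/
theorem tvNorm_eq_apply_univ_iff (w : RadonMeasure) : tvNorm w = w Set.univ ↔ 0 ≤ w := by
  rw [nonneg_iff_negPart_univ_eq_zero, tvNorm_eq_posPart_add_negPart,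
    w.apply_eq_posPart_real_sub_negPart_real .univ]
  constructor <;> intro h <;> linarith

/-! ### Low-pass coefficients as integrals of the moment curve -/

theorem integrable_of_continuous {E : Type*} [NormedAddCommGroup E]
    (w : RadonMeasure) {f : Torus → E} (hf : Continuous f) : w.Integrable f := by
  have : Fact (0 < 2 * Real.pi) := ⟨Real.two_pi_pos⟩
  exact hf.integrable_of_hasCompactSupport (HasCompactSupport.of_compactSpace f)

theorem integral_eq_posPart_sub_negPart {E : Type*} [NormedAddCommGroup E] [NormedSpace ℝ E]
    [CompleteSpace E] (w : RadonMeasure) {f : Torus → E} (hf : Continuous f) :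
    ∫ᵛ t, f t ∂<•w = ∫ t, f t ∂w.toJordanDecomposition.posPart -
      ∫ t, f t ∂w.toJordanDecomposition.negPart := by
  conv_lhs => rw [← w.toSignedMeasure_toJordanDecomposition, JordanDecomposition.toSignedMeasure]
  rw [VectorMeasure.integral_sub_vectorMeasure (integrable_of_continuous _ hf)
    (integrable_of_continuous _ hf), VectorMeasure.integral_toSignedMeasure,
    VectorMeasure.integral_toSignedMeasure]

/-- The curve `t ↦ (1, e^{-it}, …, e^{-iKt})`, the low-pass coefficients of the Dirac mass at `t`. -/
noncomputable def moment (K : ℕ) (t : Torus) : ℝ × (Fin K → ℂ) :=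
  (1, fun k => fourier (-((k : ℤ) + 1)) t)

theorem continuous_moment (K : ℕ) : Continuous (moment K) :=
  continuous_const.prodMk (continuous_pi fun _ => (fourier _).continuous)

theorem lowPass_fst (K : ℕ) (w : RadonMeasure) : (lowPass K w).1 = w Set.univ := by
  simp [lowPass, fourierCoeff_zero]

theorem lowPass_add (K : ℕ) (v w : RadonMeasure) :
    lowPass K (v + w) = lowPass K v + lowPass K w := by
  have h : ∀ k, fourierCoeff (v + w) k = fourierCoeff v k + fourierCoeff w k := fun k =>
    VectorMeasure.integral_add_vectorMeasure (integrable_of_continuous _ (fourier _).continuous)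
      (integrable_of_continuous _ (fourier _).continuous)
  ext k <;> simp [lowPass, h]

theorem lowPass_smul (K : ℕ) (c : ℝ) (w : RadonMeasure) :
    lowPass K (c • w) = c • lowPass K w := by
  have h : ∀ k, fourierCoeff (c • w) k = c • fourierCoeff w k := fun k =>
    VectorMeasure.integral_smul_vectorMeasure _ _
  ext k <;> simp [lowPass, h]

/-- The low-pass Fourier coefficients as a linear map. -/
noncomputable def lowPassₗ (K : ℕ) : RadonMeasure →ₗ[ℝ] ℝ × (Fin K → ℂ) where
  toFun := lowPass K
  map_add' := lowPass_add K
  map_smul' := lowPass_smul K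

theorem lowPass_dirac (K : ℕ) (x : Torus) (a : ℝ) :
    lowPass K (VectorMeasure.dirac x a) = a • moment K x := by
  have h : ∀ k, fourierCoeff (VectorMeasure.dirac x a) k = a • fourier (-k) x := fun k => by
    rw [fourierCoeff, VectorMeasure.integral_dirac]
    rfl
  ext k
  · simp [lowPass, h, moment]
  · simp only [lowPass, h, moment, Prod.smul_snd, Pi.smul_apply]

theorem lowPass_eq_integral (K : ℕ) (w : RadonMeasure) :
    lowPass K w = ∫ t, moment K t ∂w.toJordanDecomposition.posPart -
      ∫ t, moment K t ∂w.toJordanDecomposition.negPart := by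
  have : Fact (0 < 2 * Real.pi) := ⟨Real.two_pi_pos⟩
  have hint : ∀ (μ : Measure Torus) [IsFiniteMeasure μ], Integrable (moment K) μ := fun μ _ =>
    (continuous_moment K).integrable_of_hasCompactSupport (HasCompactSupport.of_compactSpace _)
  ext k
  · rw [lowPass_fst, w.apply_eq_posPart_real_sub_negPart_real .univ, Prod.fst_sub,
      fst_integral (hint _), fst_integral (hint _)]
    simp [moment]
  · rw [Prod.snd_sub, snd_integral (hint _), snd_integral (hint _), Pi.sub_apply,
      eval_integral fun k => (hint _).snd.eval k, eval_integral fun k => (hint _).snd.eval k]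
    exact integral_eq_posPart_sub_negPart w (fourier _).continuous

theorem map_lowPass_eq_integral (K : ℕ) (f : ℝ × (Fin K → ℂ) →ₗ[ℝ] ℝ) (w : RadonMeasure) :
    f (lowPass K w) = ∫ t, f (moment K t) ∂w.toJordanDecomposition.posPart -
      ∫ t, f (moment K t) ∂w.toJordanDecomposition.negPart := by
  have : Fact (0 < 2 * Real.pi) := ⟨Real.two_pi_pos⟩
  have hint : ∀ (μ : Measure Torus) [IsFiniteMeasure μ], Integrable (moment K) μ := fun μ _ =>
    (continuous_moment K).integrable_of_hasCompactSupport (HasCompactSupport.of_compactSpace _)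
  have h := fun (μ : Measure Torus) [IsFiniteMeasure μ] =>
    f.toContinuousLinearMap.integral_comp_comm (hint μ)
  simp only [LinearMap.coe_toContinuousLinearMap'] at h
  rw [lowPass_eq_integral, map_sub, h, h]


/-! ### Linear functionals as trigonometric polynomials, and their zeros -/

/-- The real trigonometric polynomial `α + ∑ Re (γ_k e^{-i(k+1)t})`. -/
noncomputable def trigPoly {K : ℕ} (α : ℝ) (γ : Fin K → ℂ) (t : Torus) : ℝ :=
  α + ∑ k : Fin K, (γ k * fourier (-((k : ℤ) + 1)) t).re

theorem exists_apply_eq_of_linearMap {K : ℕ} (f : ℝ × (Fin K → ℂ) →ₗ[ℝ] ℝ) :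
    ∃ (α : ℝ) (γ : Fin K → ℂ), ∀ v, f v = α * v.1 + ∑ k, (γ k * v.2 k).re := by
  -- The coefficient comes from `Re ((a - ib)(x + iy)) = ax + by`.
  refine ⟨f (1, 0), fun k => f (0, Pi.single k 1) - f (0, Pi.single k Complex.I) * Complex.I,
    fun v => ?_⟩
  have hv : v = v.1 • ((1, 0) : ℝ × (Fin K → ℂ)) +
      ∑ k, ((v.2 k).re • ((0, Pi.single k 1) : ℝ × (Fin K → ℂ)) +
        (v.2 k).im • ((0, Pi.single k Complex.I) : ℝ × (Fin K → ℂ))) := by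
    ext j
    · simp [Prod.fst_sum]
    · simp only [Prod.snd_add, Prod.smul_snd, Prod.snd_sum, Pi.add_apply, Finset.sum_apply,
        Pi.smul_apply, Pi.single_apply, Complex.real_smul, mul_ite, mul_one, mul_zero, Pi.zero_apply,
        zero_add, Finset.sum_add_distrib, Finset.sum_ite_eq, Finset.mem_univ, if_true,
        Complex.re_add_im]
  conv_lhs => rw [hv]
  simp only [map_add, map_sum, map_smul, smul_eq_mul]
  congr 1
  · ring
  · refine Finset.sum_congr rfl fun k _ => ?_
    simp
    ring

theorem fourier_eq_zpow (n : ℤ) (t : Torus) :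
    fourier n t = (AddCircle.toCircle t : ℂ) ^ n := by
  rw [fourier_apply, AddCircle.toCircle_zsmul, Circle.coe_zpow]

open Polynomial in
-- With `z = e^{it}`, `2 z^K p(t)` is the value at `z` of an algebraic polynomial `Q` of degree at
-- most `2K`. Its coefficients up to degree `K` recover `γ` and `2α`, so `Q ≠ 0`; and `t ↦ z` is
-- injective.
theorem trigPoly_zeros {K : ℕ} {α : ℝ} {γ : Fin K → ℂ} (h : α ≠ 0 ∨ γ ≠ 0) :
    {t | trigPoly α γ t = 0}.Finite ∧ {t | trigPoly α γ t = 0}.ncard ≤ 2 * K := by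
  set Q : ℂ[X] := C (2 * α : ℂ) * X ^ K + ∑ k : Fin K,
    (C (γ k) * X ^ (K - (k + 1) : ℕ) + C (starRingEnd ℂ (γ k)) * X ^ (K + (k + 1) : ℕ)) with hQ
  have hdeg : Q.natDegree ≤ 2 * K := by
    refine natDegree_add_le_of_degree_le ((natDegree_C_mul_X_pow_le _ _).trans (by omega)) ?_
    refine natDegree_sum_le_of_forall_le _ _ fun k _ => ?_
    exact natDegree_add_le_of_degree_le ((natDegree_C_mul_X_pow_le _ _).trans (by omega))
      ((natDegree_C_mul_X_pow_le _ _).trans (by omega))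
  have hne : Q ≠ 0 := by
    intro h0
    have hα : Q.coeff K = 2 * α := by
      simp only [hQ, coeff_add, coeff_C_mul_X_pow, finsetSum_coeff, if_true]
      rw [Finset.sum_eq_zero, add_zero]
      intro k _
      rw [if_neg (by omega), if_neg (by omega), add_zero]
    have hγ : ∀ j : Fin K, Q.coeff (K - (j + 1)) = γ j := fun j => by
      simp only [hQ, coeff_add, coeff_C_mul_X_pow, finsetSum_coeff]
      rw [if_neg (by omega), zero_add, Finset.sum_eq_single j]
      · rw [if_pos rfl, if_neg (by omega), add_zero]
      · intro k _ hk
        have := Fin.val_ne_of_ne hk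
        rw [if_neg (by omega), if_neg (by omega), add_zero]
      · simp
    rcases h with h | h
    · apply h
      simpa [h0] using hα.symm
    · apply h
      funext j
      simpa [h0] using (hγ j).symm
  have heval : ∀ t : Torus, Q.eval (AddCircle.toCircle t : ℂ) =
      2 * (AddCircle.toCircle t : ℂ) ^ K * (trigPoly α γ t : ℝ) := fun t => by
    have hz : (AddCircle.toCircle t : ℂ) ≠ 0 := Circle.coe_ne_zero _
    simp only [hQ, eval_add, eval_mul, eval_C, eval_pow, eval_X, eval_finsetSum, trigPoly]
    push_cast
    rw [mul_add, Finset.mul_sum]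
    congr 1
    · ring
    · refine Finset.sum_congr rfl fun k _ => ?_
      have hre := Complex.add_conj (γ k * fourier (-((k : ℤ) + 1)) t)
      push_cast at hre
      rw [mul_comm (2 : ℂ), mul_assoc, ← hre, map_mul, ← fourier_neg, neg_neg, fourier_eq_zpow, fourier_eq_zpow, mul_add]
      congr 1
      · rw [mul_left_comm, ← zpow_natCast, ← zpow_natCast, ← zpow_add₀ hz]
        congr 2
        push_cast [Nat.cast_sub (show (k : ℕ) + 1 ≤ K by omega)]
        ring
      · rw [mul_left_comm, ← zpow_natCast, ← zpow_natCast, ← zpow_add₀ hz]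
        congr 2
  set e : Torus → ℂ := fun t => (AddCircle.toCircle t : ℂ) with he
  have hinj : Function.Injective e := Subtype.coe_injective.comp
    (AddCircle.injective_toCircle Real.two_pi_pos.ne')
  have hsub : e '' {t | trigPoly α γ t = 0} ⊆ Q.roots.toFinset := by
    rintro _ ⟨t, ht, rfl⟩
    simp only [Finset.mem_coe, Multiset.mem_toFinset, mem_roots hne, IsRoot.def]
    rw [heval, show trigPoly α γ t = 0 from ht]
    simp
  refine ⟨(Q.roots.toFinset.finite_toSet.subset hsub).of_finite_image hinj.injOn, ?_⟩
  rw [← Set.ncard_image_of_injective _ hinj]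
  refine (Set.ncard_le_ncard hsub (Finset.finite_toSet _)).trans ?_
  rw [Set.ncard_coe_finset]
  exact (Multiset.toFinset_card_le _).trans ((card_roots' Q).trans hdeg)

theorem hasDerivAt_trigPoly {K : ℕ} (α : ℝ) (γ : Fin K → ℂ) (t : ℝ) :
    HasDerivAt (fun s : ℝ => trigPoly α γ (s : Torus))
      (trigPoly 0 (fun k => -(Complex.I * ((k : ℂ) + 1)) * γ k) (t : Torus)) t := by
  simp only [trigPoly, zero_add]
  refine HasDerivAt.const_add _ (HasDerivAt.fun_sum fun k _ => ?_)
  have h := (hasDerivAt_fourier (2 * Real.pi) (-((k : ℤ) + 1)) t).const_mul (γ k)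
  have h' := (Complex.reCLM.hasFDerivAt.comp_hasDerivAt t h)
  refine h'.congr_deriv ?_
  rw [Complex.reCLM_apply]
  congr 1
  have : (Real.pi : ℂ) ≠ 0 := by exact_mod_cast Real.pi_ne_zero
  push_cast
  field_simp

/-- Points where `|p| = 1` are global extrema of `p`, hence zeros of `p'`, whose coefficients
`-i(k+1)γ_k` do not all vanish. -/
theorem finite_ncard_extremal {K : ℕ} {α : ℝ} {γ : Fin K → ℂ} (hγ : γ ≠ 0)
    (h : ∀ t, |trigPoly α γ t| ≤ 1) :
    {t | |trigPoly α γ t| = 1}.Finite ∧ {t | |trigPoly α γ t| = 1}.ncard ≤ 2 * K := by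
  have hγ' : (fun k : Fin K => -(Complex.I * ((k : ℂ) + 1)) * γ k) ≠ 0 := by
    contrapose! hγ
    funext k
    have hk : ((k : ℂ) + 1) ≠ 0 := by exact_mod_cast Nat.succ_ne_zero k
    simpa [hk] using congrFun hγ k
  obtain ⟨hfin, hcard⟩ := trigPoly_zeros (α := 0) (Or.inr hγ')
  have hsub : {t | |trigPoly α γ t| = 1} ⊆
      {t | trigPoly 0 (fun k : Fin K => -(Complex.I * ((k : ℂ) + 1)) * γ k) t = 0} := by
    intro t ht
    induction t using QuotientAddGroup.induction_on with
    | H s =>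
      have hd := hasDerivAt_trigPoly α γ s
      refine IsLocalExtr.hasDerivAt_eq_zero ?_ hd
      rcases eq_or_eq_neg_of_abs_eq ht with h1 | h1
      · exact Or.inr (Filter.Eventually.of_forall fun r => (abs_le.1 (h r)).2.trans h1.ge)
      · exact Or.inl (Filter.Eventually.of_forall fun r => h1.le.trans (abs_le.1 (h r)).1)
  exact ⟨hfin.subset hsub, (Set.ncard_le_ncard hsub hfin).trans hcard⟩


/-! ### Existence of minimizers -/

theorem isCompact_convexHull_of_finiteDimensional {E : Type*} [NormedAddCommGroup E]
    [NormedSpace ℝ E] [FiniteDimensional ℝ E] {s : Set E} (hs : IsCompact s) :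
    IsCompact (convexHull ℝ s) := by
  -- Carathéodory: at most `finrank + 1` points suffice, so the hull is a finite union of continuous
  -- images of compact sets.
  have h : convexHull ℝ s = ⋃ n ∈ Finset.range (Module.finrank ℝ E + 2),
      (fun p : (Fin n → ℝ) × (Fin n → E) => ∑ i, p.1 i • p.2 i) ''
        (stdSimplex ℝ (Fin n) ×ˢ Set.univ.pi fun _ => s) := by
    apply Set.Subset.antisymm
    · intro x hx
      obtain ⟨ι, _, z, c, hz, haff, hc, hc1, rfl⟩ := eq_pos_convex_span_of_mem_convexHull hx
      have e := (Fintype.equivFin ι).symm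
      refine Set.mem_biUnion (Finset.mem_range.2 (Nat.lt_succ_of_le
        (haff.card_le_finrank_succ.trans (Nat.succ_le_succ (Submodule.finrank_le _)))))
        ⟨(c ∘ e, z ∘ e), ⟨⟨fun i => (hc _).le, ?_⟩, fun i _ => hz ⟨_, rfl⟩⟩, ?_⟩
      · simpa only [Function.comp_apply] using (e.sum_comp c).trans hc1
      · exact e.sum_comp fun i => c i • z i
    · refine Set.iUnion₂_subset fun n _ => ?_
      rintro _ ⟨⟨c, z⟩, ⟨hc, hz⟩, rfl⟩
      exact (convex_convexHull ℝ s).sum_mem (fun i _ => hc.1 i) hc.2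
        fun i _ => subset_convexHull ℝ s (hz i trivial)
  rw [h]
  refine (Finset.range _).isCompact_biUnion fun n _ => ?_
  refine ((isCompact_stdSimplex ℝ (Fin n)).prod (isCompact_univ_pi fun _ => hs)).image ?_
  fun_prop

/-- The convex hull of the moments of the Dirac masses and of their opposites. -/
def momentHull (K : ℕ) : Set (ℝ × (Fin K → ℂ)) :=
  convexHull ℝ (Set.range (moment K) ∪ -Set.range (moment K))

theorem convex_momentHull (K : ℕ) : Convex ℝ (momentHull K) := convex_convexHull ℝ _

theorem moment_mem_momentHull (K : ℕ) (t : Torus) : moment K t ∈ momentHull K :=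
  subset_convexHull ℝ _ (Or.inl ⟨t, rfl⟩)

theorem neg_mem_momentHull {K : ℕ} {v : ℝ × (Fin K → ℂ)} (hv : v ∈ momentHull K) :
    -v ∈ momentHull K := by
  rw [← Set.mem_neg, momentHull, ← convexHull_neg, Set.union_neg, neg_neg, Set.union_comm]
  exact hv

theorem isCompact_momentHull (K : ℕ) : IsCompact (momentHull K) := by
  have : Fact (0 < 2 * Real.pi) := ⟨Real.two_pi_pos⟩
  have h := isCompact_range (continuous_moment K)
  exact isCompact_convexHull_of_finiteDimensional (h.union h.neg)

/-- Together with `lowPass_mem_smul_momentHull`, this identifies the hull with the image of the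
total-variation unit ball. -/
theorem exists_tvNorm_le_one_of_mem_momentHull {K : ℕ} {v : ℝ × (Fin K → ℂ)}
    (hv : v ∈ momentHull K) : ∃ w : RadonMeasure, tvNorm w ≤ 1 ∧ lowPass K w = v := by
  have hconv : Convex ℝ {w : RadonMeasure | tvNorm w ≤ 1} := by
    intro x hx y hy a b ha hb hab
    refine (tvNorm_add_le _ _).trans ?_
    rw [tvNorm_smul, tvNorm_smul, abs_of_nonneg ha, abs_of_nonneg hb]
    calc a * tvNorm x + b * tvNorm y ≤ a * 1 + b * 1 := by gcongr <;> assumption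
      _ = 1 := by linarith
  refine convexHull_min ?_ (hconv.linear_image (lowPassₗ K)) hv
  rintro _ (⟨t, rfl⟩ | ⟨t, ht⟩)
  · refine ⟨VectorMeasure.dirac t 1, by simp [tvNorm_dirac], ?_⟩
    exact (lowPass_dirac K t 1).trans (one_smul _ _)
  · refine ⟨VectorMeasure.dirac t (-1), by simp [tvNorm_dirac], ?_⟩
    refine (lowPass_dirac K t (-1)).trans ?_
    rw [ht, neg_one_smul, neg_neg]

/-- The average of the moment curve stays in the closed convex hull. -/
theorem integral_moment_mem {K : ℕ} (μ : Measure Torus) [IsFiniteMeasure μ] :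
    ∃ v ∈ momentHull K, ∫ t, moment K t ∂μ = μ.real Set.univ • v := by
  have : Fact (0 < 2 * Real.pi) := ⟨Real.two_pi_pos⟩
  rcases eq_or_ne μ 0 with rfl | hμ
  · exact ⟨_, moment_mem_momentHull K 0, by simp⟩
  · have : NeZero μ := ⟨hμ⟩
    refine ⟨⨍ t, moment K t ∂μ, (convex_momentHull K).average_mem
      (isCompact_momentHull K).isClosed (.of_forall (moment_mem_momentHull K))
      ((continuous_moment K).integrable_of_hasCompactSupport (HasCompactSupport.of_compactSpace _)),
      ?_⟩
    rw [measure_smul_average]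

theorem lowPass_mem_smul_momentHull {K : ℕ} (w : RadonMeasure) :
    ∃ v ∈ momentHull K, lowPass K w = tvNorm w • v := by
  obtain ⟨a, ha, hpos⟩ := integral_moment_mem (K := K) w.toJordanDecomposition.posPart
  obtain ⟨b, hb, hneg⟩ := integral_moment_mem (K := K) w.toJordanDecomposition.negPart
  have hmem := Set.add_mem_add (Set.smul_mem_smul_set (a := w.toJordanDecomposition.posPart.real
    Set.univ) ha) (Set.smul_mem_smul_set (a := w.toJordanDecomposition.negPart.real Set.univ)
    (neg_mem_momentHull hb))
  rw [← (convex_momentHull K).add_smul measureReal_nonneg measureReal_nonneg,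
    ← tvNorm_eq_posPart_add_negPart] at hmem
  obtain ⟨v, hv, h⟩ := hmem
  refine ⟨v, hv, ?_⟩
  rw [lowPass_eq_integral, hpos, hneg, sub_eq_add_neg, ← smul_neg]
  exact h.symm

/-- A functional vanishing on the range vanishes on all moments, so it is a trigonometric polynomial
with infinitely many zeros. -/
theorem lowPass_surjective (K : ℕ) : Function.Surjective (lowPass K) := by
  have : Fact (0 < 2 * Real.pi) := ⟨Real.two_pi_pos⟩
  suffices h : LinearMap.range (lowPassₗ K) = ⊤ from LinearMap.range_eq_top.1 h
  by_contra hne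
  obtain ⟨f, hf0, hf⟩ := Submodule.exists_le_ker_of_lt_top _ (lt_top_iff_ne_top.2 hne)
  obtain ⟨α, γ, hfγ⟩ := exists_apply_eq_of_linearMap f
  have hzero : ∀ t, trigPoly α γ t = 0 := fun t => by
    have h : f (moment K t) = 0 := hf ⟨VectorMeasure.dirac t 1,
      (lowPass_dirac K t 1).trans (one_smul _ _)⟩
    rw [hfγ] at h
    simpa [moment, trigPoly] using h
  have hαγ : ¬ (α ≠ 0 ∨ γ ≠ 0) := fun h => by
    have := (Set.Ico_infinite (lt_add_of_pos_right (0 : ℝ) Real.two_pi_pos)).to_subtype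
    have : Infinite Torus := (AddCircle.equivIco (2 * Real.pi) 0).infinite_iff.2 this
    refine Set.infinite_univ (α := Torus) ((trigPoly_zeros h).1.subset fun t _ => hzero t)
  push Not at hαγ
  apply hf0
  ext1 <;> ext <;> simp [hfγ, hαγ.1, hαγ.2]

theorem solutionSet_nonempty {K : ℕ} (y : ℝ × (Fin K → ℂ)) : (solutionSet K y).Nonempty := by
  obtain ⟨w, hw⟩ := lowPass_surjective K y
  -- Minimizing the norm becomes minimizing `r` over pairs `(r, u)` with `r • u = y` and `u` in the
  -- hull; the bound on `r` makes this set compact.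
  set A : Set (ℝ × (ℝ × (Fin K → ℂ))) :=
    (Set.Icc 0 (tvNorm w) ×ˢ momentHull K) ∩ {p | p.1 • p.2 = y} with hA
  have hAc : IsCompact A := (isCompact_Icc.prod (isCompact_momentHull K)).inter_right
    (isClosed_eq (continuous_fst.smul continuous_snd) continuous_const)
  have hAmem : ∀ v, lowPass K v = y → tvNorm v ≤ tvNorm w → ∃ s, (tvNorm v, s) ∈ A := by
    intro v hv hvw
    obtain ⟨s, hs, h⟩ := lowPass_mem_smul_momentHull (K := K) v
    exact ⟨s, ⟨⟨tvNorm_nonneg v, hvw⟩, hs⟩, h.symm.trans hv⟩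
  obtain ⟨s, hs⟩ := hAmem w hw le_rfl
  obtain ⟨⟨r, u⟩, ⟨⟨⟨hr0, hrw⟩, hu⟩, hru⟩, hmin⟩ :=
    hAc.exists_isMinOn ⟨_, hs⟩ continuous_fst.continuousOn
  obtain ⟨m, hm1, hm⟩ := exists_tvNorm_le_one_of_mem_momentHull hu
  refine ⟨r • m, by rw [lowPass_smul, hm]; exact hru, fun v hv => ?_⟩
  have hrm : tvNorm (r • m) ≤ r := by
    rw [tvNorm_smul, abs_of_nonneg hr0]
    exact mul_le_of_le_one_right hr0 hm1
  refine hrm.trans ?_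
  rcases le_total (tvNorm v) (tvNorm w) with h | h
  · obtain ⟨s', hs'⟩ := hAmem v hv h
    exact hmin hs'
  · exact le_trans hrw h

/-! ### Duality -/

/-- Existence of a dual certificate. -/
theorem exists_dual_certificate {K : ℕ} {y : ℝ × (Fin K → ℂ)} (hy : y ≠ 0) {w : RadonMeasure}
    (hw : w ∈ solutionSet K y) :
    ∃ f : ℝ × (Fin K → ℂ) →ₗ[ℝ] ℝ, (∀ t, |f (moment K t)| ≤ 1) ∧ f y = tvNorm w := by
  choose σ hσ using fun v => solutionSet_nonempty (K := K) v
  -- `N` is the quotient norm, the least norm of a measure with given coefficients. It is sublinear,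
  -- so Hahn–Banach extends `c • y ↦ c * N y` below it; testing on `±` Dirac masses bounds the
  -- extension on moments.
  set N : ℝ × (Fin K → ℂ) → ℝ := fun v => tvNorm (σ v) with hN
  have hle : ∀ u v, lowPass K u = v → N v ≤ tvNorm u := fun u v h => (hσ v).2 u h
  have hNy : N y = tvNorm w := le_antisymm (hle w y hw.1) (hw.2 _ (hσ y).1)
  have hsmul_le : ∀ c : ℝ, 0 < c → ∀ x, N (c • x) ≤ c * N x := fun c hc x => by
    refine (hle (c • σ x) _ ?_).trans_eq ?_
    · rw [lowPass_smul, (hσ x).1]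
    · rw [tvNorm_smul, abs_of_pos hc]
  have hsmul : ∀ c : ℝ, 0 < c → ∀ x, N (c • x) = c * N x := fun c hc x => by
    refine le_antisymm (hsmul_le c hc x) ?_
    have h := hsmul_le c⁻¹ (inv_pos.2 hc) (c • x)
    rw [inv_smul_smul₀ hc.ne'] at h
    rwa [← le_inv_mul_iff₀ hc]
  have hadd : ∀ x z, N (x + z) ≤ N x + N z := fun x z =>
    (hle (σ x + σ z) _ (by rw [lowPass_add, (hσ x).1, (hσ z).1])).trans (tvNorm_add_le _ _)
  obtain ⟨f, hf, hfN⟩ := exists_extension_of_le_sublinear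
    (LinearPMap.mkSpanSingleton (σ := RingHom.id ℝ) y (N y) hy) N hsmul hadd (by
      rintro ⟨x, hx⟩
      obtain ⟨c, rfl⟩ := Submodule.mem_span_singleton.1 hx
      rw [LinearPMap.mkSpanSingleton'_apply]
      rcases lt_or_ge 0 c with hc | hc
      · exact (hsmul c hc y).ge
      · exact (mul_nonpos_of_nonpos_of_nonneg hc (tvNorm_nonneg _)).trans (tvNorm_nonneg _))
  have hmoment : ∀ (t : Torus) (a : ℝ), |a| = 1 → a * f (moment K t) ≤ 1 := fun t a ha => by
    rw [← smul_eq_mul, ← map_smul, ← lowPass_dirac]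
    exact (hfN _).trans ((hle _ _ rfl).trans_eq (by rw [tvNorm_dirac, ha]))
  refine ⟨f, fun t => abs_le.2 ⟨?_, ?_⟩, ?_⟩
  · linarith [hmoment t (-1) (by simp)]
  · linarith [hmoment t 1 (by simp)]
  · have h := hf ⟨y, Submodule.mem_span_singleton_self y⟩
    rw [← hNy]
    refine h.trans ?_
    exact LinearPMap.mkSpanSingleton'_apply_self _ _ _ _


/-! ### Discrete measures and the support of minimizers -/

theorem tvNorm_zero : tvNorm 0 = 0 := by
  simp [tvNorm, SignedMeasure.totalVariation_zero]

theorem tvNorm_sum_dirac_le {ι : Type*} (s : Finset ι) (x : ι → Torus) (a : ι → ℝ) :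
    tvNorm (∑ i ∈ s, VectorMeasure.dirac (x i) (a i)) ≤ ∑ i ∈ s, |a i| := by
  refine (Finset.le_sum_of_subadditive _ tvNorm_zero.le tvNorm_add_le _ _).trans_eq ?_
  simp only [tvNorm_dirac]

theorem lowPass_sum_dirac {ι : Type*} (K : ℕ) (s : Finset ι) (x : ι → Torus) (a : ι → ℝ) :
    lowPass K (∑ i ∈ s, VectorMeasure.dirac (x i) (a i)) = ∑ i ∈ s, a i • moment K (x i) :=
  (map_sum (lowPassₗ K) _ _).trans (Finset.sum_congr rfl fun _ _ => lowPass_dirac K _ _)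

theorem eq_sum_dirac (w : RadonMeasure) (s : Finset Torus)
    (h : ∀ E, MeasurableSet E → Disjoint E s → w E = 0) :
    w = ∑ x ∈ s, VectorMeasure.dirac x (w {x}) := by
  classical
  ext E hE
  have hEs : E ∩ s = ⋃ x ∈ s.filter (· ∈ E), {x} := by
    ext x
    simp [and_comm]
  have hsum : (∑ x ∈ s, VectorMeasure.dirac x (w {x})) E =
      ∑ x ∈ s, VectorMeasure.dirac x (w {x}) E := by
    rw [FunLike.coe_sum, Finset.sum_apply]
  rw [← Set.inter_union_sdiff E s, VectorMeasure.of_union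
    (Set.disjoint_sdiff_right.mono_left Set.inter_subset_right)
    (hE.inter s.measurableSet) (hE.diff s.measurableSet),
    h _ (hE.diff s.measurableSet) Set.disjoint_sdiff_left, add_zero, Set.inter_union_sdiff, hsum, hEs,
    VectorMeasure.of_biUnion_finset (fun x _ z _ hxz => Set.disjoint_singleton.2 hxz)
      (fun x _ => measurableSet_singleton x), Finset.sum_filter]
  refine Finset.sum_congr rfl fun x _ => ?_
  split_ifs with hx
  · rw [VectorMeasure.dirac_apply_of_mem hE hx]
  · rw [VectorMeasure.dirac_apply_of_notMem hx]

/-- As `b` is real, conjugation yields the positive frequencies, so `2K + 1` consecutive frequencies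
vanish: a Vandermonde system. -/
theorem moment_independent {K : ℕ} (s : Finset Torus) (hs : s.card ≤ 2 * K + 1) (b : Torus → ℝ)
    (h : ∑ x ∈ s, b x • moment K x = 0) : ∀ x ∈ s, b x = 0 := by
  have hneg : ∀ k : Fin K, ∑ x ∈ s, (b x : ℂ) * fourier (-((k : ℤ) + 1)) x = 0 := fun k => by
    simpa [Prod.snd_sum, moment, -fourier_apply] using congrFun (congrArg Prod.snd h) k
  have hpos : ∀ k : Fin K, ∑ x ∈ s, (b x : ℂ) * fourier ((k : ℤ) + 1) x = 0 := fun k => by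
    have := congrArg (starRingEnd ℂ) (hneg k)
    simpa only [map_sum, map_mul, Complex.conj_ofReal, ← fourier_neg, neg_neg, map_zero] using this
  have hzero : ∑ x ∈ s, (b x : ℂ) * fourier 0 x = 0 := by
    have := congrArg (Complex.ofReal ∘ Prod.fst) h
    simpa [Prod.fst_sum, moment] using this
  have hall : ∀ m : ℤ, |m| ≤ K → ∑ x ∈ s, (b x : ℂ) * fourier m x = 0 := by
    intro m hm
    rw [abs_le] at hm
    rcases lt_trichotomy m 0 with hm0 | rfl | hm0
    · obtain ⟨k, rfl⟩ : ∃ k : ℕ, m = -((k : ℤ) + 1) := ⟨(-m - 1).toNat, by omega⟩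
      exact hneg ⟨k, by omega⟩
    · exact hzero
    · obtain ⟨k, rfl⟩ : ∃ k : ℕ, m = (k : ℤ) + 1 := ⟨(m - 1).toNat, by omega⟩
      exact hpos ⟨k, by omega⟩
  have e := s.equivFin.symm
  have hinj : Function.Injective fun i => (AddCircle.toCircle (e i : Torus) : ℂ) :=
    Subtype.coe_injective.comp ((AddCircle.injective_toCircle Real.two_pi_pos.ne').comp
      (Subtype.coe_injective.comp e.injective))
  have hv := Matrix.eq_zero_of_forall_pow_sum_mul_pow_eq_zero hinj
    -- The factor `z^{-K}` shifts the exponents `0, …, 2K` to the frequencies `-K, …, K`.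
    (v := fun i => (b (e i) : ℂ) * (AddCircle.toCircle (e i : Torus) : ℂ) ^ (-(K : ℤ))) (by
      intro j
      have hj := hall ((j : ℤ) - K) (abs_le.2 ⟨by omega, by omega⟩)
      rw [← Finset.sum_coe_sort, ← e.sum_comp] at hj
      rw [← hj]
      refine Finset.sum_congr rfl fun i _ => ?_
      rw [fourier_eq_zpow, mul_assoc, ← zpow_natCast, ← zpow_add₀ (Circle.coe_ne_zero _)]
      congr 2
      ring)
  intro x hx
  have := congrFun hv (e.symm ⟨x, hx⟩)
  have hne : (AddCircle.toCircle x : ℂ) ≠ 0 := Circle.coe_ne_zero _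
  simpa [hne] using this

/-- From `‖w‖ = f(lowPass w) ≤ ∫ |p| d|w| ≤ ‖w‖`, the nonnegative function `1 - |p|` has zero
integral against `|w|`. -/
theorem totalVariation_certificate {K : ℕ} {f : ℝ × (Fin K → ℂ) →ₗ[ℝ] ℝ} {w : RadonMeasure}
    (hf : ∀ t, |f (moment K t)| ≤ 1) (hw : f (lowPass K w) = tvNorm w) :
    w.totalVariation {t | |f (moment K t)| = 1}ᶜ = 0 := by
  have : Fact (0 < 2 * Real.pi) := ⟨Real.two_pi_pos⟩
  have hcont : Continuous fun t => f (moment K t) :=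
    f.continuous_of_finiteDimensional.comp (continuous_moment K)
  have hint : ∀ (μ : Measure Torus) [IsFiniteMeasure μ] {g : Torus → ℝ}, Continuous g →
      Integrable g μ := fun μ _ g hg =>
    hg.integrable_of_hasCompactSupport (HasCompactSupport.of_compactSpace _)
  have hle : tvNorm w ≤ ∫ t, |f (moment K t)| ∂w.totalVariation := by
    rw [← hw, map_lowPass_eq_integral, SignedMeasure.totalVariation,
      integral_add_measure (hint _ hcont.abs) (hint _ hcont.abs), sub_eq_add_neg, ← integral_neg]
    exact add_le_add
      (integral_mono (hint _ hcont) (hint _ hcont.abs) fun t => le_abs_self _)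
      (integral_mono (hint _ hcont.neg) (hint _ hcont.abs) fun t => neg_le_abs _)
  have hzero : ∫ t, (1 - |f (moment K t)|) ∂w.totalVariation = 0 := by
    refine le_antisymm ?_ (integral_nonneg fun t => sub_nonneg.2 (hf t))
    rw [integral_sub (integrable_const _) (hint _ hcont.abs), integral_const, smul_eq_mul, mul_one]
    exact sub_nonpos.2 hle
  rw [integral_eq_zero_iff_of_nonneg (fun t => sub_nonneg.2 (hf t))
    (hint _ (continuous_const.sub hcont.abs))] at hzero
  refine measure_mono_null (fun t ht => ?_) hzero
  simp only [Set.mem_compl_iff, Set.mem_ofPred_eq, Pi.zero_apply] at ht ⊢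
  exact fun h => ht (by linarith)

/-! ### The two halves of the theorem -/

theorem solutionSet_eq_nonnegRepresenting {K : ℕ} {y : ℝ × (Fin K → ℂ)} {w₀ : RadonMeasure}
    (h0 : 0 ≤ w₀) (hy : lowPass K w₀ = y) : solutionSet K y = nonnegRepresenting K y := by
  have huniv : ∀ v, lowPass K v = y → v Set.univ = y.1 := fun v hv => by
    rw [← lowPass_fst K, hv]
  ext w
  constructor
  · rintro ⟨hw, hmin⟩
    refine ⟨(tvNorm_eq_apply_univ_iff w).1 (le_antisymm ?_ (apply_univ_le_tvNorm w)), hw⟩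
    rw [huniv w hw, ← huniv w₀ hy, ← (tvNorm_eq_apply_univ_iff w₀).2 h0]
    exact hmin w₀ hy
  · rintro ⟨hpos, hw⟩
    refine ⟨hw, fun v hv => ?_⟩
    rw [(tvNorm_eq_apply_univ_iff w).2 hpos, huniv w hw, ← huniv v hv]
    exact apply_univ_le_tvNorm v

theorem exists_solutionSet_eq_singleton {K : ℕ} {y : ℝ × (Fin K → ℂ)} (hy : 0 ≤ y.1)
    (hnot : ¬ ∃ w₀ : RadonMeasure, 0 ≤ w₀ ∧ lowPass K w₀ = y) :
    ∃ (n : ℕ) (a : Fin n → ℝ) (x : Fin n → Torus),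
      n ≤ 2 * K ∧ Function.Injective x ∧ (∀ i, a i ≠ 0) ∧ (∃ i, 0 < a i) ∧ (∃ i, a i < 0) ∧
      solutionSet K y = {∑ i, VectorMeasure.dirac (x i) (a i)} := by
  classical
  obtain ⟨w, hw⟩ := solutionSet_nonempty y
  have hlt : y.1 < tvNorm w := by
    by_contra! hle
    refine hnot ⟨w, (tvNorm_eq_apply_univ_iff w).1 (le_antisymm ?_ (apply_univ_le_tvNorm w)), hw.1⟩
    rwa [← lowPass_fst K, hw.1]
  have hy0 : y ≠ 0 := by
    rintro rfl
    exact hnot ⟨0, le_rfl, (lowPassₗ K).map_zero⟩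
  obtain ⟨f, hf, hfy⟩ := exists_dual_certificate hy0 hw
  obtain ⟨α, γ, hfγ⟩ := exists_apply_eq_of_linearMap f
  have hp : ∀ t, f (moment K t) = trigPoly α γ t := fun t => by
    simp [hfγ, moment, trigPoly]
  -- A constant certificate would give `‖w‖ = α y₀ ≤ y₀`, against `hlt`.
  have hγ : γ ≠ 0 := by
    rintro rfl
    have hα : |α| ≤ 1 := by simpa [hp, trigPoly] using hf 0
    have hαy : α * y.1 = tvNorm w := by simpa [hfγ] using hfy
    have := mul_le_mul_of_nonneg_right ((le_abs_self α).trans hα) hy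
    linarith
  obtain ⟨hfin, hcard⟩ := finite_ncard_extremal hγ fun t => hp t ▸ hf t
  set s : Finset Torus := hfin.toFinset with hs
  have hscard : s.card ≤ 2 * K := by rwa [← Set.ncard_eq_toFinset_card _ hfin]
  have hrep : ∀ v ∈ solutionSet K y, v = ∑ t ∈ s, VectorMeasure.dirac t (v {t}) := by
    intro v hv
    have hvw : tvNorm v = tvNorm w := le_antisymm (hv.2 w hw.1) (hw.2 v hv.1)
    refine eq_sum_dirac v s fun E _ hE => v.null_of_totalVariation_zero (measure_mono_null ?_
      (totalVariation_certificate hf (w := v) (by rw [hv.1, hfy, hvw])))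
    intro t ht hts
    refine Set.disjoint_left.1 hE ht ?_
    simpa [hs, ← hp] using hts
  have huniq : solutionSet K y = {w} := by
    refine Set.eq_singleton_iff_unique_mem.2 ⟨hw, fun v hv => ?_⟩
    have hsum : ∑ t ∈ s, (v {t} - w {t}) • moment K t = 0 := by
      simp only [sub_smul, Finset.sum_sub_distrib]
      rw [← lowPass_sum_dirac, ← lowPass_sum_dirac, ← hrep v hv, ← hrep w hw, hv.1, hw.1, sub_self]
    have hz := moment_independent s (by omega) (fun t => v {t} - w {t}) hsum
    rw [hrep v hv, hrep w hw]
    exact Finset.sum_congr rfl fun t ht => by rw [sub_eq_zero.1 (hz t ht)]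
  -- Extremal points of `p` may carry no mass; only actual atoms are kept.
  set s' := s.filter fun t => w {t} ≠ 0 with hs'
  have e := s'.equivFin.symm
  have hwsum : w = ∑ i, VectorMeasure.dirac (e i : Torus) (w {(e i : Torus)}) := by
    rw [e.sum_comp fun t : s' => VectorMeasure.dirac (t : Torus) (w {(t : Torus)}),
      Finset.sum_coe_sort s' fun t => VectorMeasure.dirac t (w {t}), hs', Finset.sum_filter_of_ne]
    · exact hrep w hw
    · intro t _ ht h0
      exact ht (by rw [h0, VectorMeasure.dirac_zero])
  have htv : tvNorm w ≤ ∑ i, |w {(e i : Torus)}| := by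
    conv_lhs => rw [hwsum]
    exact tvNorm_sum_dirac_le _ _ _
  have hmass : y.1 = ∑ i, w {(e i : Torus)} := by
    rw [← hw.1]
    conv_lhs => rw [hwsum]
    rw [lowPass_sum_dirac, Prod.fst_sum]
    simp [moment]
  refine ⟨s'.card, fun i => w {(e i : Torus)}, fun i => e i,
    (Finset.card_filter_le _ _).trans hscard, Subtype.coe_injective.comp e.injective,
    fun i => (Finset.mem_filter.1 (e i).2).2, ?_, ?_, by rw [← hwsum, huniq]⟩
  -- Without a positive weight `‖w‖ ≤ -y₀ ≤ y₀`; without a negative one `‖w‖ ≤ y₀`.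
  · by_contra! hneg
    rw [Finset.sum_congr rfl fun i _ => abs_of_nonpos (hneg i), Finset.sum_neg_distrib] at htv
    linarith
  · by_contra! hpos
    rw [Finset.sum_congr rfl fun i _ => abs_of_nonneg (hpos i)] at htv
    linarith

end FourierTV

theorem mainTheorem2 (Kc : ℕ) (y : ℝ × (Fin Kc → ℂ)) :
    List.TFAE
      [ ∃ w₀ : FourierTV.RadonMeasure, 0 ≤ w₀ ∧ FourierTV.lowPass Kc w₀ = y,
        FourierTV.solutionSet Kc y = FourierTV.nonnegRepresenting Kc y,
        IsLeast (FourierTV.tvNorm '' {w | FourierTV.lowPass Kc w = y}) y.1 ] ∧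
    (0 ≤ y.1 →
      ¬ (∃ w₀ : FourierTV.RadonMeasure, 0 ≤ w₀ ∧ FourierTV.lowPass Kc w₀ = y) →
      ∃ (n : ℕ) (a : Fin n → ℝ) (x : Fin n → FourierTV.Torus),
        n ≤ 2 * Kc ∧ Function.Injective x ∧ (∀ i, a i ≠ 0) ∧
        (∃ i, 0 < a i) ∧ (∃ i, a i < 0) ∧
        FourierTV.solutionSet Kc y = {∑ i, VectorMeasure.dirac (x i) (a i)}) := by
  refine ⟨?_, FourierTV.exists_solutionSet_eq_singleton⟩
  tfae_have 1 → 2 := fun ⟨_, h0, hw⟩ => FourierTV.solutionSet_eq_nonnegRepresenting h0 hw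
  tfae_have 2 → 1 := fun h => by
    obtain ⟨w, hw⟩ := FourierTV.solutionSet_nonempty y
    rw [h] at hw
    exact ⟨w, hw⟩
  tfae_have 1 → 3 := by
    rintro ⟨w, h0, rfl⟩
    rw [FourierTV.lowPass_fst]
    refine ⟨⟨w, rfl, (FourierTV.tvNorm_eq_apply_univ_iff w).2 h0⟩, ?_⟩
    rintro _ ⟨v, hv, rfl⟩
    rw [← FourierTV.lowPass_fst Kc, ← show _ = _ from hv, FourierTV.lowPass_fst]
    exact FourierTV.apply_univ_le_tvNorm v
  tfae_have 3 → 1 := by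
    rintro ⟨⟨w, hw, h⟩, -⟩
    refine ⟨w, (FourierTV.tvNorm_eq_apply_univ_iff w).1 ?_, hw⟩
    rw [h, ← FourierTV.lowPass_fst Kc, show _ = _ from hw]
  tfae_finish
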